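/- Let $\mathcal M$ be a von Neumann algebra. For a von Neumann subalgebra $\mathcal L\subseteq\mathcal M$, let $\mathcal{GN}(\mathcal M,\mathcal L)$ denote the set of partial isometries $v\in\mathcal M$ with $v^*\mathcal L v\cup v\mathcal L v^*\subseteq\mathcal L$. A Cartan triple $(\mathcal M,\mathcal N,\mathcal D)$ consists of von Neumann algebras such that $\mathcal D$ is an abelian von Neumann subalgebra of $\mathcal M$ for which the linear span of $\mathcal{GN}(\mathcal M,\mathcal D)$ is weak-$*$ dense in $\mathcal M$, $\mathcal N=\{m\in\mathcal M: dm=md\text{ for all }d\in\mathcal D\}$, and there is a faithful normal conditional expectation $E:\mathcal M\to\mathcal N$. The triple is full if $\mathcal D$ is the center of $\mathcal N$. **Theorem.** Let $(\mathcal M,\mathcal N,\mathcal D)$ be a full Cartan triple and let $\mathcal B\subseteq\mathcal M$ be a nonzero weak-$*$-closed $\mathcal N$-bimodule, that is, a nonzero weak-$*$-closed linear subspace with $\mathcal N\mathcal B\cup\mathcal B\mathcal N\subseteq\mathcal B$. Then $\mathcal{GN}(\mathcal M,\mathcal D)\cap\mathcal B\neq\{0\}$; that is, $\mathcal B$ contains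 a nonzero element of $\mathcal{GN}(\mathcal M,\mathcal D)$. In fact, for every faithful normal conditional expectation $E:\mathcal M\to\mathcal N$, every $x\in\mathcal B$ and every $v\in\mathcal{GN}(\mathcal M,\mathcal D)$, the element $vE(v^*x)$ is a linear combination of at most four elements of $\mathcal{GN}(\mathcal M,\mathcal D)\cap\mathcal B$. -/

import Mathlib

open Topology

/-- The ultraweak (`σ`-weak, weak-`*`) topology on the bounded operators on a Hilbert space `H`,
i.e. the weak-`*` topology of `B(H)` as the dual of the trace class operators: the coarsest
topology for which all functionals `x ↦ ∑ ⟨ξ n, x (η n)⟩`, where `∑ ‖ξ n‖² < ∞` and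
`∑ ‖η n‖² < ∞`, are continuous. (These series converge absolutely.) -/
@[reducible] noncomputable def ultraweakTopology (H : Type*) [NormedAddCommGroup H] [InnerProductSpace ℂ H]
    [CompleteSpace H] : TopologicalSpace (H →L[ℂ] H) :=
  ⨅ p : {p : (ℕ → H) × (ℕ → H) //
      Summable (fun n => ‖p.1 n‖ ^ 2) ∧ Summable (fun n => ‖p.2 n‖ ^ 2)},
    TopologicalSpace.induced
      (fun x : H →L[ℂ] H => ∑' n, inner ℂ (p.1.1 n) (x (p.1.2 n))) inferInstance

namespace VonNeumannAlgebra

variable {H : Type*} [NormedAddCommGroup H] [InnerProductSpace ℂ H] [CompleteSpace H]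

/-- The weak-`*` topology of a von Neumann algebra `M` acting on `H`: the restriction to `M` of
the ultraweak topology of `B(H)`. -/
@[reducible] noncomputable def weakStarTopology (M : VonNeumannAlgebra H) :
    TopologicalSpace M.toStarSubalgebra :=
  TopologicalSpace.induced Subtype.val (ultraweakTopology H)

/-- The groupoid normalizer `GN(M, L)` of `L` in `M`: the partial isometries `v` of `M` with
`v* L v ⊆ L` and `v L v* ⊆ L`. -/
def groupoidNormalizer (M L : VonNeumannAlgebra H) : Set M.toStarSubalgebra :=
  {v | v * star v * v = v ∧
    ∀ d ∈ L, star (v : H →L[ℂ] H) * d * v ∈ L ∧ (v : H →L[ℂ] H) * d * star (v : H →L[ℂ] H) ∈ L}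

/-- `L` is regular in `M`: the linear span of the groupoid normalizer is weak-`*` dense in `M`. -/
def IsRegularIn (L M : VonNeumannAlgebra H) : Prop :=
  @Dense _ M.weakStarTopology
    (Submodule.span ℂ (groupoidNormalizer M L) : Set M.toStarSubalgebra)

/-- A faithful normal conditional expectation `E` of `M` onto the von Neumann subalgebra `N`:
a positive linear `N`-bimodule map that restricts to the identity on `N`, vanishes on `x* x` only
for `x = 0`, and is continuous for the weak-`*` topologies. -/
structure IsFaithfulNormalCondExp (M N : VonNeumannAlgebra H)
    (E : M.toStarSubalgebra →ₗ[ℂ] N.toStarSubalgebra) : Prop where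
  le : N ≤ M
  map_of_mem : ∀ x : M.toStarSubalgebra, (x : H →L[ℂ] H) ∈ N →
    (E x : H →L[ℂ] H) = x
  map_mul_mul : ∀ a x b : M.toStarSubalgebra, (a : H →L[ℂ] H) ∈ N → (b : H →L[ℂ] H) ∈ N →
    (E (a * x * b) : H →L[ℂ] H) = a * E x * b
  positive : ∀ x : M.toStarSubalgebra, (E (star x * x) : H →L[ℂ] H).IsPositive
  faithful : ∀ x : M.toStarSubalgebra, E (star x * x) = 0 → x = 0
  normal : Continuous[M.weakStarTopology, N.weakStarTopology] E

/-- `(M, N, D)` is a Cartan triple: `D` is an abelian regular von Neumann subalgebra of `M`, `N` is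
the relative commutant of `D` in `M`, and there is a faithful normal conditional expectation of
`M` onto `N`. -/
structure IsCartanTriple (M N D : VonNeumannAlgebra H) : Prop where
  le : D ≤ M
  abelian : ∀ a ∈ D, ∀ b ∈ D, a * b = b * a
  regular : D.IsRegularIn M
  relCommutant : ∀ x : H →L[ℂ] H, x ∈ N ↔ x ∈ M ∧ ∀ d ∈ D, d * x = x * d
  exists_condExp : ∃ E : M.toStarSubalgebra →ₗ[ℂ] N.toStarSubalgebra,
    IsFaithfulNormalCondExp M N E

/-- A Cartan triple `(M, N, D)` is full when `D` is the center of `N`. -/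
structure IsFullCartanTriple (M N D : VonNeumannAlgebra H) : Prop extends
    IsCartanTriple M N D where
  full : ∀ x : H →L[ℂ] H, x ∈ D ↔ x ∈ N ∧ ∀ n ∈ N, n * x = x * n

/-- A linear subspace `B` of `M` is an `N`-bimodule (`N` a von Neumann subalgebra of `M`): it is
stable under left and right multiplication by elements of `N`. -/
def IsBimodule (M N : VonNeumannAlgebra H) (B : Submodule ℂ M.toStarSubalgebra) : Prop :=
  ∀ n b : M.toStarSubalgebra, (n : H →L[ℂ] H) ∈ N → b ∈ B → n * b ∈ B ∧ b * n ∈ B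

end VonNeumannAlgebra

/-!
Fix a faithful normal conditional expectation `E : M → N`, an element `x` of the bimodule `B` and
`v` in the groupoid normalizer of `D`.

*The element `v E(v* x)` lies in `B`.* The unitary group of `D` is abelian, so by a
Markov–Kakutani argument in the weakly compact ball of `M` the weakly closed convex hull of the
conjugates `u y u*` of `y = v* x` meets `D' ∩ M = N`. As `E` is constant on that hull, it meets `N`
exactly in `E y` (`IsFaithfulNormalCondExp.coe_apply_mem`). Since `v u v* x u* = (v u v*) x u*` lies
in `B` for each unitary `u` of `D`, so does `v E(v* x)`
(`IsFaithfulNormalCondExp.mul_apply_mem`).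

*It is a combination of four normalizers in `B`.* Since `v m = (v m v*) v` for `m ∈ N`, the set
`J = {m ∈ N | v m ∈ B}` is a weakly closed two-sided ideal of `N`, hence has a unit `e`, which is a
projection of the center of `N` (`exists_central_projection_of_ideal`); fullness puts `e` into `D`.
Writing `E(v* x) ∈ J` as a combination of four unitaries `uᵢ` of `N` gives
`v E(v* x) = ∑ cᵢ v e uᵢ`, where `v e uᵢ` is in `B` because `e uᵢ ∈ J`, and in the groupoid
normalizer because `uᵢ` commutes with `D`
(`IsFullCartanTriple.exists_sum_four_groupoidNormalizer`).

*Some `v E(v* x)` is nonzero if `x ≠ 0`.* Otherwise `E(z x) = 0` for `z` in the weak-`*` dense span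
of the groupoid normalizer, hence for `z = x*`, against faithfulness
(`IsFaithfulNormalCondExp.exists_mul_apply_ne_zero`).

All compactness arguments take place on norm bounded sets, where the ultraweak topology is the weak
operator topology; they are phrased with ultrafilters of operators.
-/

open Filter

namespace ContinuousLinearMap

variable {H : Type*} [NormedAddCommGroup H] [InnerProductSpace ℂ H] [CompleteSpace H]

/-! ### Bounded weak operator limits -/

/-- The filter `l` on `B(H)` converges to `a` in the weak operator topology. -/
def WeakOpTendsto (l : Filter (H →L[ℂ] H)) (a : H →L[ℂ] H) : Prop :=
  ∀ ξ η : H, Tendsto (fun z : H →L[ℂ] H => inner ℂ ξ (z η)) l (𝓝 (inner ℂ ξ (a η)))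

/-- A set of operators is boundedly weakly closed if it contains the weak operator limits of its
norm bounded ultrafilters. Since the weak operator and the ultraweak topology agree on bounded
sets, every ultraweakly closed set has this property. -/
def IsBddWeakClosed (S : Set (H →L[ℂ] H)) : Prop :=
  ∀ (U : Ultrafilter (H →L[ℂ] H)) (C : ℝ) (a : H →L[ℂ] H), S ∈ U →
    (∀ᶠ z in (U : Filter (H →L[ℂ] H)), ‖z‖ ≤ C) → WeakOpTendsto (U : Filter (H →L[ℂ] H)) a → a ∈ S

omit [CompleteSpace H] in
theorem WeakOpTendsto.unique {l : Filter (H →L[ℂ] H)} [l.NeBot] {a b : H →L[ℂ] H}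
    (ha : WeakOpTendsto l a) (hb : WeakOpTendsto l b) : a = b := by
  ext η
  exact ext_inner_left ℂ fun ξ => tendsto_nhds_unique (ha ξ η) (hb ξ η)

theorem weakOpTendsto_of_le_nhds {l : Filter (H →L[ℂ] H)} {a : H →L[ℂ] H} (h : l ≤ 𝓝 a) :
    WeakOpTendsto l a := fun ξ η => by
  have : Continuous fun z : H →L[ℂ] H => inner ℂ ξ (z η) := by fun_prop
  exact (this.tendsto a).mono_left h

theorem WeakOpTendsto.mul_mul {l : Filter (H →L[ℂ] H)} {a : H →L[ℂ] H} (h : WeakOpTendsto l a)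
    (b c : H →L[ℂ] H) : WeakOpTendsto (l.map fun z => b * z * c) (b * a * c) := fun ξ η => by
  rw [tendsto_map'_iff]
  simpa [Function.comp_def, adjoint_inner_left] using h (adjoint b ξ) (c η)

theorem WeakOpTendsto.star {l : Filter (H →L[ℂ] H)} {a : H →L[ℂ] H} (h : WeakOpTendsto l a) :
    WeakOpTendsto (l.map star) (star a) := fun ξ η => by
  rw [tendsto_map'_iff]
  have := (Complex.continuous_conj.tendsto _).comp (h η ξ)
  simpa [Function.comp_def, star_eq_adjoint, adjoint_inner_right] using this

/-- Weak operator compactness of the balls of `B(H)`: a bounded ultrafilter of operators converges,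
its limit being the operator representing the limit of the sesquilinear forms. -/
theorem exists_weakOpTendsto (U : Ultrafilter (H →L[ℂ] H)) {C : ℝ}
    (hC : ∀ᶠ z in (U : Filter (H →L[ℂ] H)), ‖z‖ ≤ C) :
    ∃ a : H →L[ℂ] H, WeakOpTendsto (U : Filter (H →L[ℂ] H)) a := by
  have hb : ∀ ξ η : H, ∀ᶠ z : H →L[ℂ] H in U, ‖inner ℂ ξ (z η)‖ ≤ C * ‖ξ‖ * ‖η‖ := by
    intro ξ η
    filter_upwards [hC] with z hz
    calc ‖inner ℂ ξ (z η)‖ ≤ ‖ξ‖ * ‖z η‖ := norm_inner_le_norm _ _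
      _ ≤ ‖ξ‖ * (C * ‖η‖) := by gcongr; exact z.le_of_opNorm_le hz η
      _ = C * ‖ξ‖ * ‖η‖ := by ring
  have hlim : ∀ ξ η : H, ∃ c : ℂ, Tendsto (fun z : H →L[ℂ] H => inner ℂ ξ (z η)) U (𝓝 c) := by
    intro ξ η
    obtain ⟨c, -, hc⟩ := (isCompact_closedBall (0 : ℂ) (C * ‖ξ‖ * ‖η‖)).ultrafilter_le_nhds
      (U.map fun z : H →L[ℂ] H => inner ℂ ξ (z η)) (by
        rw [Ultrafilter.coe_map, le_principal_iff, mem_map]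
        filter_upwards [hb ξ η] with z hz
        simpa using hz)
    exact ⟨c, hc⟩
  choose B hB using hlim
  have huniq : ∀ {ξ η c}, Tendsto (fun z : H →L[ℂ] H => inner ℂ ξ (z η)) U (𝓝 c) → B ξ η = c :=
    fun h => tendsto_nhds_unique (hB _ _) h
  let L : H →L⋆[ℂ] H →L[ℂ] ℂ := LinearMap.mkContinuous₂
    (LinearMap.mk₂'ₛₗ (starRingEnd ℂ) (RingHom.id ℂ) B
      (fun x y z => huniq (by simpa [inner_add_left] using (hB x z).add (hB y z)))
      (fun c x z => huniq (by
        simpa [inner_smul_left, mul_comm] using (hB x z).const_mul (starRingEnd ℂ c)))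
      (fun x y z => huniq (by simpa [inner_add_right] using (hB x y).add (hB x z)))
      (fun c x z => huniq (by simpa [inner_smul_right] using (hB x z).const_mul _)))
    C (fun ξ η => le_of_tendsto (hB ξ η).norm (hb ξ η))
  refine ⟨adjoint (InnerProductSpace.continuousLinearMapOfBilin L), fun ξ η => ?_⟩
  rw [adjoint_inner_right, InnerProductSpace.continuousLinearMapOfBilin_apply]
  exact hB ξ η

namespace IsBddWeakClosed

variable {S T : Set (H →L[ℂ] H)}

omit [CompleteSpace H] in
theorem inter (hS : IsBddWeakClosed S) (hT : IsBddWeakClosed T) : IsBddWeakClosed (S ∩ T) :=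
  fun U C a hU hC ha => ⟨hS U C a (mem_of_superset hU Set.inter_subset_left) hC ha,
    hT U C a (mem_of_superset hU Set.inter_subset_right) hC ha⟩

omit [CompleteSpace H] in
theorem iInter {ι : Sort*} {S : ι → Set (H →L[ℂ] H)} (hS : ∀ i, IsBddWeakClosed (S i)) :
    IsBddWeakClosed (⋂ i, S i) :=
  fun U C a hU hC ha => Set.mem_iInter.2 fun i =>
    hS i U C a (mem_of_superset hU (Set.iInter_subset S i)) hC ha

theorem preimage_mul_mul (hS : IsBddWeakClosed S) (b c : H →L[ℂ] H) :
    IsBddWeakClosed {z | b * z * c ∈ S} := fun U C a hU hC ha => by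
  refine hS (U.map fun z => b * z * c) (‖b‖ * C * ‖c‖) _ hU ?_ (ha.mul_mul b c)
  rw [Ultrafilter.coe_map, eventually_map]
  filter_upwards [hC] with z hz
  calc ‖b * z * c‖ ≤ ‖b‖ * ‖z‖ * ‖c‖ := (norm_mul_le _ _).trans (by gcongr; exact norm_mul_le _ _)
    _ ≤ ‖b‖ * C * ‖c‖ := by gcongr

theorem preimage_mul_left (hS : IsBddWeakClosed S) (b : H →L[ℂ] H) :
    IsBddWeakClosed {z | b * z ∈ S} := by
  simpa using hS.preimage_mul_mul b 1

theorem preimage_star (hS : IsBddWeakClosed S) : IsBddWeakClosed {z | star z ∈ S} :=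
  fun U C a hU hC ha => by
    refine hS (U.map star) C _ hU ?_ ha.star
    rw [Ultrafilter.coe_map, eventually_map]
    simpa using hC

theorem isClosed (hS : IsBddWeakClosed S) : IsClosed S := by
  refine isClosed_iff_ultrafilter.2 fun a U hU hS' => ?_
  refine hS U (‖a‖ + 1) a hS' (hU ?_) (weakOpTendsto_of_le_nhds hU)
  exact (continuous_norm.tendsto a).eventually_le_const (by linarith)

end IsBddWeakClosed

omit [CompleteSpace H] in
theorem isBddWeakClosed_closedBall (r : ℝ) :
    IsBddWeakClosed (Metric.closedBall (0 : H →L[ℂ] H) r) := fun U C a hU _ ha => by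
  have hr : 0 ≤ r := by
    obtain ⟨z, hz⟩ := U.nonempty_of_mem hU
    exact dist_nonneg.trans hz
  rw [mem_closedBall_zero_iff]
  refine opNorm_le_of_re_inner_le (𝕜 := ℂ) hr fun x y hx hy => ?_
  rw [inner_re_symm]
  refine (RCLike.re_le_norm _).trans (le_of_tendsto (ha y x).norm ?_)
  filter_upwards [hU] with z hz
  calc ‖inner ℂ y (z x)‖ ≤ ‖y‖ * ‖z x‖ := norm_inner_le_norm _ _
    _ ≤ ‖y‖ * (r * ‖x‖) := by gcongr; exact z.le_of_opNorm_le (mem_closedBall_zero_iff.1 hz) x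
    _ = r := by rw [hx, hy]; ring

theorem isBddWeakClosed_commute (u : H →L[ℂ] H) : IsBddWeakClosed {z | u * z = z * u} :=
  fun U C a hU _ ha => by
    have h1 := ha.mul_mul u 1
    have h2 := ha.mul_mul 1 u
    simp only [mul_one, one_mul] at h1 h2
    rw [map_congr (m₂ := fun z => z * u) hU] at h1
    exact h1.unique h2

/-! ### Fixed points of commuting inner automorphisms -/

/-- One step of the Markov–Kakutani theorem: limits of the averages
`(n + 1)⁻¹ ∑_{k ≤ n} uᵏ z u⁻ᵏ` commute with `u`. -/
theorem exists_mem_commute_unitary {K : Set (H →L[ℂ] H)} (hK : IsBddWeakClosed K)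
    {C : ℝ} (hC : ∀ z ∈ K, ‖z‖ ≤ C) (hconv : Convex ℝ K) (hne : K.Nonempty) {u : H →L[ℂ] H}
    (hu : u ∈ unitary (H →L[ℂ] H)) (hinv : ∀ z ∈ K, u * z * star u ∈ K) :
    ∃ z ∈ K, u * z = z * u := by
  obtain ⟨z₀, hz₀⟩ := hne
  let f : ℕ → H →L[ℂ] H := fun k => (fun z => u * z * star u)^[k] z₀
  have hf : ∀ k, f k ∈ K := by
    intro k
    induction k with
    | zero => exact hz₀
    | succ k ih => simpa only [f, Function.iterate_succ_apply'] using hinv _ ih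
  have hfs : ∀ k, u * f k = f (k + 1) * u := by
    intro k
    simp only [f, Function.iterate_succ_apply', mul_assoc, Unitary.star_mul_self_of_mem hu, mul_one]
  let g : ℕ → H →L[ℂ] H := fun n => ∑ k ∈ Finset.range (n + 1), ((n : ℝ) + 1)⁻¹ • f k
  have hg : ∀ n, g n ∈ K := fun n => by
    refine hconv.sum_mem (fun _ _ => by positivity) ?_ fun k _ => hf k
    simp
    field_simp
  have hdiff : ∀ n, u * g n - g n * u = ((n : ℝ) + 1)⁻¹ • ((f (n + 1) - f 0) * u) := by
    intro n
    simp only [g, ← Finset.smul_sum, mul_smul_comm, smul_mul_assoc, Finset.mul_sum, Finset.sum_mul,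
      hfs, ← smul_sub, ← Finset.sum_sub_distrib, ← sub_mul]
    rw [← Finset.sum_mul, Finset.sum_range_sub]
  have hlim : Tendsto (fun n => u * g n - g n * u) atTop (𝓝 0) := by
    refine squeeze_zero_norm (a := fun n : ℕ => 1 / ((n : ℝ) + 1) * (2 * C * ‖u‖)) (fun n => ?_) ?_
    · rw [hdiff, norm_smul, Real.norm_of_nonneg (by positivity), one_div]
      gcongr
      refine (norm_mul_le _ _).trans ?_
      gcongr
      refine (norm_sub_le _ _).trans ?_
      linarith [hC _ (hf (n + 1)), hC _ (hf 0)]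
    · simpa using tendsto_one_div_add_atTop_nhds_zero_nat.mul_const (2 * C * ‖u‖)
  clear_value g
  obtain ⟨V, hV⟩ : ∃ V : Ultrafilter ℕ, (V : Filter ℕ) ≤ atTop := ⟨_, Ultrafilter.of_le atTop⟩
  let U : Ultrafilter (H →L[ℂ] H) := V.map g
  have hUC : ∀ᶠ z in (U : Filter (H →L[ℂ] H)), ‖z‖ ≤ C :=
    eventually_map.2 (.of_forall fun n => hC _ (hg n))
  obtain ⟨a, ha⟩ := exists_weakOpTendsto U hUC
  refine ⟨a, hK U C a (mem_map.2 (univ_mem' hg) : K ∈ (U : Filter _)) hUC ha, ?_⟩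
  ext η
  refine ext_inner_left ℂ fun ξ => sub_eq_zero.1 (tendsto_nhds_unique
    (f := fun n => inner ℂ ξ ((u * g n) η) - inner ℂ ξ ((g n * u) η))
    (l := (V : Filter ℕ)) ?_ ?_)
  · have h1 := ha.mul_mul u 1 ξ η
    have h2 := ha.mul_mul 1 u ξ η
    simp only [U, Ultrafilter.coe_map, tendsto_map'_iff, Function.comp_def, mul_one,
      one_mul] at h1 h2
    exact h1.sub h2
  · have hc : Continuous fun z : H →L[ℂ] H => inner ℂ ξ (z η) := by fun_prop
    have h := (hc.tendsto 0).comp (hlim.mono_left hV)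
    simpa only [Function.comp_def, sub_apply, zero_apply, inner_sub_right, inner_zero_right] using h

/-- The Markov–Kakutani theorem for conjugations by commuting unitaries: a nonempty bounded
convex boundedly weakly closed set that is stable under these conjugations contains an operator
commuting with all of them. -/
theorem exists_mem_forall_commute_unitary {K : Set (H →L[ℂ] H)} (hK : IsBddWeakClosed K)
    {C : ℝ} (hC : ∀ z ∈ K, ‖z‖ ≤ C) (hconv : Convex ℝ K) (hne : K.Nonempty)
    {S : Set (H →L[ℂ] H)} (hS : S ⊆ unitary (H →L[ℂ] H))
    (hcomm : ∀ u ∈ S, ∀ w ∈ S, u * w = w * u) (hinv : ∀ u ∈ S, ∀ z ∈ K, u * z * star u ∈ K) :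
    ∃ z ∈ K, ∀ u ∈ S, u * z = z * u := by
  classical
  have hfin : ∀ F : Finset S, ∃ z ∈ K, ∀ u ∈ F, (u : H →L[ℂ] H) * z = z * u := by
    intro F
    induction F using Finset.induction_on with
    | empty => exact ⟨_, hne.some_mem, by simp⟩
    | insert u F _ ih =>
      let K' : Set (H →L[ℂ] H) := K ∩ ⋂ w : F, {z | ((w : S) : H →L[ℂ] H) * z = z * (w : S)}
      have hmem : ∀ z, z ∈ K' ↔ z ∈ K ∧ ∀ w ∈ F, (w : H →L[ℂ] H) * z = z * w := by
        intro z
        simp [K']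
      obtain ⟨z, hz, hzu⟩ := exists_mem_commute_unitary (K := K') (u := u)
        (hK.inter (.iInter fun w => isBddWeakClosed_commute _)) (fun z hz => hC z hz.1)
        (fun x hx y hy a b ha hb hab => by
          rw [hmem] at hx hy ⊢
          refine ⟨hconv hx.1 hy.1 ha hb hab, fun w hw => ?_⟩
          simp only [mul_add, add_mul, mul_smul_comm, smul_mul_assoc, hx.2 w hw, hy.2 w hw])
        (by
          obtain ⟨z, hz, h⟩ := ih
          exact ⟨z, (hmem z).2 ⟨hz, h⟩⟩)
        (hS u.2) (fun z hz => by
          rw [hmem] at hz ⊢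
          refine ⟨hinv u u.2 z hz.1, fun w hw => ?_⟩
          have hwu : (w : H →L[ℂ] H) * u = u * w := hcomm w w.2 u u.2
          have hwu' : (w : H →L[ℂ] H) * star (u : H →L[ℂ] H) = star (u : H →L[ℂ] H) * w := by
            have h1 := Unitary.star_mul_self_of_mem (hS u.2)
            have h2 := Unitary.mul_star_self_of_mem (hS u.2)
            calc (w : H →L[ℂ] H) * star (u : H →L[ℂ] H)
                = star (u : H →L[ℂ] H) * (u * w) * star (u : H →L[ℂ] H) := by
                  rw [← mul_assoc, h1, one_mul]
              _ = star (u : H →L[ℂ] H) * w := by rw [← hwu, mul_assoc, mul_assoc, h2, mul_one]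
          calc (w : H →L[ℂ] H) * (u * z * star (u : H →L[ℂ] H))
              = u * (w * z) * star (u : H →L[ℂ] H) := by simp only [← mul_assoc, hwu]
            _ = u * z * star (u : H →L[ℂ] H) * w := by
              rw [hz.2 w hw]; simp only [mul_assoc, hwu'])
      refine ⟨z, hz.1, fun w hw => ?_⟩
      rcases Finset.mem_insert.1 hw with rfl | hw
      · exact hzu
      · exact ((hmem z).1 hz).2 w hw
  choose z hz hzF using hfin
  let V : Ultrafilter (Finset S) := Ultrafilter.of atTop
  let U : Ultrafilter (H →L[ℂ] H) := V.map z
  have hUC : ∀ᶠ z in (U : Filter (H →L[ℂ] H)), ‖z‖ ≤ C :=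
    eventually_map.2 (.of_forall fun n => hC _ (hz n))
  obtain ⟨a, ha⟩ := exists_weakOpTendsto U hUC
  refine ⟨a, hK U C a (mem_map.2 (univ_mem' hz) : K ∈ (U : Filter _)) hUC ha, fun u hu => ?_⟩
  refine isBddWeakClosed_commute u U C a ?_ hUC ha
  have : ∀ᶠ F in (V : Filter (Finset S)), u * z F = z F * u :=
    Ultrafilter.of_le atTop ((eventually_ge_atTop {⟨u, hu⟩}).mono fun F hF =>
      hzF F ⟨u, hu⟩ (hF (by simp)))
  exact this

/-! ### The ultraweak topology -/

/-- On norm bounded sets weak operator convergence is ultraweak convergence, by dominated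
convergence of the series defining the ultraweak functionals. -/
theorem WeakOpTendsto.tendsto_ultraweak {l : Filter (H →L[ℂ] H)} {a : H →L[ℂ] H}
    (h : WeakOpTendsto l a) {C : ℝ} (hC : ∀ᶠ z in l, ‖z‖ ≤ C) :
    l ≤ @nhds _ (ultraweakTopology H) a := by
  rw [nhds_iInf]
  refine le_iInf fun p => ?_
  rw [nhds_induced, ← tendsto_iff_comap]
  have hsum : Summable fun n => C * (‖p.1.1 n‖ ^ 2 + ‖p.1.2 n‖ ^ 2) := (p.2.1.add p.2.2).mul_left C
  refine tendsto_tsum_of_dominated_convergence hsum (fun n => h _ _) ?_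
  filter_upwards [hC] with z hz n
  have hC0 : 0 ≤ C := (norm_nonneg z).trans hz
  calc ‖inner ℂ (p.1.1 n) (z (p.1.2 n))‖ ≤ ‖p.1.1 n‖ * ‖z (p.1.2 n)‖ := norm_inner_le_norm _ _
    _ ≤ ‖p.1.1 n‖ * (C * ‖p.1.2 n‖) := by gcongr; exact z.le_of_opNorm_le hz _
    _ = C * (‖p.1.1 n‖ * ‖p.1.2 n‖) := by ring
    _ ≤ C * (‖p.1.1 n‖ ^ 2 + ‖p.1.2 n‖ ^ 2) := by
      gcongr
      nlinarith [sq_nonneg (‖p.1.1 n‖ - ‖p.1.2 n‖), sq_nonneg ‖p.1.1 n‖, sq_nonneg ‖p.1.2 n‖]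

theorem isBddWeakClosed_of_isClosed_ultraweak {S : Set (H →L[ℂ] H)}
    (hS : IsClosed[ultraweakTopology H] S) : IsBddWeakClosed S := fun U C a hU hC ha => by
  let _ := ultraweakTopology H
  exact (isClosed_iff_ultrafilter.1 hS) a U (ha.tendsto_ultraweak hC) hU

theorem continuous_ultraweak_inner (ξ η : H) :
    Continuous[ultraweakTopology H, inferInstance] fun z : H →L[ℂ] H => inner ℂ ξ (z η) := by
  have hs : ∀ ζ : H, Summable fun n => ‖(Pi.single 0 ζ : ℕ → H) n‖ ^ 2 := fun ζ =>
    summable_of_ne_finset_zero (s := {0}) fun n hn => by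
      simp [Pi.single_eq_of_ne (Finset.notMem_singleton.1 hn)]
  -- The functional is the member of the defining family given by sequences supported at `0`.
  have h := continuous_iInf_dom (t₂ := inferInstance) (i :=
    (⟨(Pi.single 0 ξ, Pi.single 0 η), hs ξ, hs η⟩ :
    {p : (ℕ → H) × (ℕ → H) // Summable (fun n => ‖p.1 n‖ ^ 2) ∧ Summable (fun n => ‖p.2 n‖ ^ 2)}))
    (t₁ := fun p => TopologicalSpace.induced
      (fun x : H →L[ℂ] H => ∑' n, inner ℂ (p.1.1 n) (x (p.1.2 n))) inferInstance)
    continuous_induced_dom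
  convert h using 2 with z
  rw [tsum_eq_single 0 fun n hn => by simp [Pi.single_eq_of_ne hn]]
  simp

theorem isClosed_ultraweak_singleton (a : H →L[ℂ] H) : IsClosed[ultraweakTopology H] {a} := by
  let _ := ultraweakTopology H
  have : ({a} : Set (H →L[ℂ] H)) = ⋂ ξ : H, ⋂ η : H, {z | inner ℂ ξ (z η) = inner ℂ ξ (a η)} := by
    ext z
    simp only [Set.mem_singleton_iff, Set.mem_iInter, Set.mem_ofPred_eq]
    refine ⟨fun h ξ η => by rw [h], fun h => ?_⟩
    ext η
    exact ext_inner_left ℂ fun ξ => h ξ η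
  rw [this]
  exact isClosed_iInter fun ξ => isClosed_iInter fun η =>
    isClosed_singleton.preimage (continuous_ultraweak_inner ξ η)

theorem continuous_ultraweak_mul_right (b : H →L[ℂ] H) :
    Continuous[ultraweakTopology H, ultraweakTopology H] fun z : H →L[ℂ] H => z * b := by
  refine continuous_iInf_rng.2 fun p => continuous_induced_rng.2 ?_
  have hs : Summable fun n => ‖b (p.1.2 n)‖ ^ 2 :=
    (p.2.2.mul_left (‖b‖ ^ 2)).of_nonneg_of_le (fun n => by positivity) fun n => by
      rw [← mul_pow]
      gcongr
      exact b.le_opNorm _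
  exact continuous_iInf_dom (i := (⟨(p.1.1, fun n => b (p.1.2 n)), p.2.1, hs⟩ :
    {p : (ℕ → H) × (ℕ → H) // Summable (fun n => ‖p.1 n‖ ^ 2) ∧ Summable (fun n => ‖p.2 n‖ ^ 2)}))
    continuous_induced_dom

end ContinuousLinearMap

namespace VonNeumannAlgebra

open ContinuousLinearMap

variable {H : Type*} [NormedAddCommGroup H] [InnerProductSpace ℂ H] [CompleteSpace H]
  {M N D : VonNeumannAlgebra H}

/-- A von Neumann algebra is boundedly weakly closed, being a commutant. -/
theorem isBddWeakClosed (A : VonNeumannAlgebra H) : IsBddWeakClosed (A : Set (H →L[ℂ] H)) := by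
  have : (A : Set (H →L[ℂ] H)) = ⋂ u : A.commutant, {z | (u : H →L[ℂ] H) * z = z * u} := by
    ext z
    rw [SetLike.mem_coe]
    conv_lhs => rw [← A.commutant_commutant, mem_commutant_iff]
    simp
  rw [this]
  exact .iInter fun u => isBddWeakClosed_commute _

theorem isBddWeakClosed_image {A : VonNeumannAlgebra H} {S : Set A.toStarSubalgebra}
    (hS : IsClosed[A.weakStarTopology] S) :
    IsBddWeakClosed (Subtype.val '' S : Set (H →L[ℂ] H)) := by
  obtain ⟨T, hT, rfl⟩ := (@isClosed_induced_iff _ _ (ultraweakTopology H) _ _).1 hS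
  rw [show (Subtype.val '' (Subtype.val ⁻¹' T : Set A.toStarSubalgebra) : Set (H →L[ℂ] H)) =
    (A : Set (H →L[ℂ] H)) ∩ T
    from Subtype.image_preimage_coe _ _]
  exact A.isBddWeakClosed.inter (isBddWeakClosed_of_isClosed_ultraweak hT)

theorem isClosed_weakStar_singleton {A : VonNeumannAlgebra H} (a : A.toStarSubalgebra) :
    IsClosed[A.weakStarTopology] {a} := by
  refine (@isClosed_induced_iff _ _ (ultraweakTopology H) _ _).2
    ⟨{(a : H →L[ℂ] H)}, isClosed_ultraweak_singleton _, ?_⟩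
  ext z
  exact Subtype.ext_iff.symm

theorem continuous_weakStar_mul_right {A : VonNeumannAlgebra H} (b : A.toStarSubalgebra) :
    Continuous[A.weakStarTopology, A.weakStarTopology] fun z => z * b :=
  (@continuous_induced_rng _ _ _ Subtype.val _ (ultraweakTopology H) A.weakStarTopology).2
    (@Continuous.comp _ _ _ A.weakStarTopology (ultraweakTopology H) (ultraweakTopology H) _ _
      (continuous_ultraweak_mul_right (b : H →L[ℂ] H))
      (@continuous_induced_dom _ _ _ (ultraweakTopology H)))

theorem exists_sum_four_unitary (A : VonNeumannAlgebra H) {a : H →L[ℂ] H} (ha : a ∈ A) :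
    ∃ (u : Fin 4 → H →L[ℂ] H) (c : Fin 4 → ℂ), (∀ i, u i ∈ A) ∧
      (∀ i, u i ∈ unitary (H →L[ℂ] H)) ∧ a = ∑ i, c i • u i := by
  have : IsClosed (A.toStarSubalgebra : Set (H →L[ℂ] H)) := A.isBddWeakClosed.isClosed
  obtain ⟨u, c, h, -⟩ := CStarAlgebra.exists_sum_four_unitary (⟨a, ha⟩ : A.toStarSubalgebra)
  refine ⟨fun i => ((u i : A.toStarSubalgebra) : H →L[ℂ] H), c, fun i => (u i).1.2, fun i => ?_, ?_⟩
  · have h1 := congrArg Subtype.val (Unitary.coe_star_mul_self (u i))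
    have h2 := congrArg Subtype.val (Unitary.coe_mul_star_self (u i))
    exact Unitary.mem_iff.2 ⟨h1, h2⟩
  · simpa using congrArg Subtype.val h

/-! ### Ideals of von Neumann algebras -/

/-- A boundedly weakly closed two-sided ideal of a von Neumann algebra has a left unit which is a
central projection. It is the weak limit of an approximate unit of the C⋆-algebra of those
elements of the ideal whose adjoint lies in the ideal too. -/
theorem exists_central_projection_of_ideal (J : Submodule ℂ (H →L[ℂ] H))
    (hJ : IsBddWeakClosed (J : Set (H →L[ℂ] H))) (hJN : ∀ z ∈ J, z ∈ N)
    (hl : ∀ m ∈ N, ∀ z ∈ J, m * z ∈ J) (hr : ∀ m ∈ N, ∀ z ∈ J, z * m ∈ J) :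
    ∃ e ∈ J, star e = e ∧ e * e = e ∧ (∀ m ∈ N, m * e = e * m) ∧ ∀ z ∈ J, e * z = z := by
  let A : NonUnitalStarSubalgebra ℂ (H →L[ℂ] H) :=
    { carrier := {z | z ∈ J ∧ star z ∈ J}
      add_mem' := fun ha hb => ⟨J.add_mem ha.1 hb.1, by
        rw [star_add]; exact J.add_mem ha.2 hb.2⟩
      zero_mem' := by simp
      mul_mem' := fun {a b} ha hb => ⟨hl a (hJN a ha.1) b hb.1, by
        rw [star_mul]; exact hl _ (hJN _ hb.2) _ ha.2⟩
      smul_mem' := fun c a ha => ⟨J.smul_mem c ha.1, by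
        rw [star_smul]; exact J.smul_mem _ ha.2⟩
      star_mem' := fun {a} ha => ⟨ha.2, by rw [star_star]; exact ha.1⟩ }
  have hmem : ∀ {z}, z ∈ A ↔ z ∈ J ∧ star z ∈ J := Iff.rfl
  have hAw : IsBddWeakClosed (A : Set (H →L[ℂ] H)) := hJ.inter hJ.preimage_star
  have hAc : IsClosed (A : Set (H →L[ℂ] H)) := hAw.isClosed
  let _ := CStarAlgebra.spectralOrder A
  let _ := CStarAlgebra.spectralOrderedRing A
  have hau := CStarAlgebra.increasingApproximateUnit A
  let V : Ultrafilter A := Ultrafilter.of (CStarAlgebra.approximateUnit A)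
  have hV : (V : Filter A) ≤ CStarAlgebra.approximateUnit A := Ultrafilter.of_le _
  let U : Ultrafilter (H →L[ℂ] H) := V.map Subtype.val
  have hUC : ∀ᶠ z in (U : Filter (H →L[ℂ] H)), ‖z‖ ≤ 1 :=
    eventually_map.2 (hV hau.eventually_norm)
  obtain ⟨e, he⟩ := exists_weakOpTendsto U hUC
  have heA : e ∈ A := hAw U 1 e (univ_mem' (f := (V : Filter A)) fun z => z.2) hUC he
  have heleft : ∀ a ∈ A, e * a = a := fun a ha => by
    have h1 : Tendsto (fun z : A => (z : H →L[ℂ] H) * a) V (𝓝 a) :=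
      (continuous_subtype_val.tendsto _).comp ((hau.tendsto_mul_right ⟨a, ha⟩).mono_left hV)
    have h2 := he.mul_mul 1 a
    simp only [one_mul] at h2
    exact h2.unique (weakOpTendsto_of_le_nhds h1)
  have heright : ∀ a ∈ A, a * e = a := fun a ha => by
    have h1 : Tendsto (fun z : A => a * (z : H →L[ℂ] H)) V (𝓝 a) :=
      (continuous_subtype_val.tendsto _).comp ((hau.tendsto_mul_left ⟨a, ha⟩).mono_left hV)
    have h2 := he.mul_mul a 1
    simp only [mul_one] at h2
    exact h2.unique (weakOpTendsto_of_le_nhds h1)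
  have hstar : star e = e := by
    have h1 := heleft _ (star_mem heA)
    have h2 := congrArg star h1
    rw [star_mul, star_star] at h2
    exact h1.symm.trans h2
  have hN : ∀ m ∈ N, m * e ∈ A ∧ e * m ∈ A := fun m hm => by
    refine ⟨hmem.2 ⟨hl m hm e heA.1, ?_⟩, hmem.2 ⟨hr m hm e heA.1, ?_⟩⟩
    · rw [star_mul, hstar]; exact hr _ (star_mem hm) _ heA.1
    · rw [star_mul, hstar]; exact hl _ (star_mem hm) _ heA.1
  refine ⟨e, heA.1, hstar, heleft e heA, fun m hm => ?_, fun z hz => ?_⟩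
  · rw [← heleft _ (hN m hm).1, ← mul_assoc, heright _ (hN m hm).2]
  · -- `z z*` lies in the C⋆-algebra, so `(z - e z) (z - e z)* = 0`.
    have hzz : z * star z ∈ A := hmem.2 ⟨hr _ (star_mem (hJN z hz)) z hz, by
      rw [star_mul, star_star]; exact hr _ (star_mem (hJN z hz)) z hz⟩
    have h0 : (z - e * z) * star (z - e * z) = 0 := by
      have h1 := heleft _ hzz
      calc (z - e * z) * star (z - e * z)
          = (z * star z - e * (z * star z)) - (z * star z - e * (z * star z)) * star e := by
            rw [star_sub, star_mul]; noncomm_ring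
        _ = 0 := by rw [h1]; simp
    exact (sub_eq_zero.1 (CStarRing.mul_star_self_eq_zero_iff _ |>.1 h0)).symm

/-! ### Cartan triples -/

theorem IsCartanTriple.le_relCommutant (h : IsCartanTriple M N D) : D ≤ N := fun d hd =>
  (h.relCommutant d).2 ⟨h.le hd, fun c hc => h.abelian c hc d hd⟩

theorem IsCartanTriple.commute (h : IsCartanTriple M N D) {d n : H →L[ℂ] H} (hd : d ∈ D)
    (hn : n ∈ N) : d * n = n * d :=
  ((h.relCommutant n).1 hn).2 d hd

theorem star_mul_self_mem {v : M.toStarSubalgebra} (hv : v ∈ groupoidNormalizer M D) :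
    star (v : H →L[ℂ] H) * v ∈ D := by
  simpa using (hv.2 1 (one_mem D)).1

theorem mul_star_self_mem {v : M.toStarSubalgebra} (hv : v ∈ groupoidNormalizer M D) :
    (v : H →L[ℂ] H) * star (v : H →L[ℂ] H) ∈ D := by
  simpa using (hv.2 1 (one_mem D)).2

theorem mul_star_mul_self {v : M.toStarSubalgebra} (hv : v ∈ groupoidNormalizer M D) :
    (v : H →L[ℂ] H) * (star (v : H →L[ℂ] H) * v) = v := by
  rw [← mul_assoc]
  exact congrArg Subtype.val hv.1

theorem star_mul_mul_star {v : M.toStarSubalgebra} (hv : v ∈ groupoidNormalizer M D) :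
    star (v : H →L[ℂ] H) * (v * star (v : H →L[ℂ] H)) = star (v : H →L[ℂ] H) := by
  simpa [mul_assoc] using congrArg star (mul_star_mul_self hv)

theorem star_mem_groupoidNormalizer {v : M.toStarSubalgebra} (hv : v ∈ groupoidNormalizer M D) :
    star v ∈ groupoidNormalizer M D := by
  refine ⟨?_, fun d hd => ?_⟩
  · simpa [mul_assoc] using congrArg star hv.1
  · simpa using (hv.2 d hd).symm

/-- An element of the groupoid normalizer moves across elements of the relative commutant:
`v m = (v m v*) v`. -/
theorem IsCartanTriple.conj_mul (h : IsCartanTriple M N D) {v : M.toStarSubalgebra}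
    (hv : v ∈ groupoidNormalizer M D) {m : H →L[ℂ] H} (hm : m ∈ N) :
    v * m * star (v : H →L[ℂ] H) * v = v * m := by
  rw [mul_assoc, mul_assoc, ← h.commute (star_mul_self_mem hv) hm, ← mul_assoc,
    mul_star_mul_self hv]

/-- Conjugation by `v` in the groupoid normalizer preserves the relative commutant: for `d ∈ D`,
`d v m v* = v (v* d v) m v*`, and `v* d v ∈ D` commutes with `m`. -/
theorem IsCartanTriple.conj_mem (h : IsCartanTriple M N D) {v : M.toStarSubalgebra}
    (hv : v ∈ groupoidNormalizer M D) {m : H →L[ℂ] H} (hm : m ∈ N) :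
    v * m * star (v : H →L[ℂ] H) ∈ N := by
  refine (h.relCommutant _).2 ⟨mul_mem (mul_mem v.2 ((h.relCommutant m).1 hm).1)
    (star_mem v.2), fun d hd => ?_⟩
  have h1 := h.commute (hv.2 d hd).1 hm
  have h2 := h.abelian d hd _ (mul_star_self_mem hv)
  have h3 := mul_star_mul_self hv
  have h4 := star_mul_mul_star hv
  generalize star (v : H →L[ℂ] H) = w at *
  generalize (v : H →L[ℂ] H) = v at *
  calc d * (v * m * w) = d * (v * w) * v * m * w := by
        rw [mul_assoc d, mul_assoc v w v, h3]; simp only [mul_assoc]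
    _ = v * (w * d * v * m) * w := by rw [h2]; simp only [mul_assoc]
    _ = v * m * w * (d * (v * w)) := by rw [h1]; simp only [mul_assoc]
    _ = v * m * (w * (v * w)) * d := by rw [h2]; simp only [mul_assoc]
    _ = v * m * w * d := by rw [h4]

/-- For `v` in the groupoid normalizer, a unitary `u` of the relative commutant and a projection `e`
of `D`, the product `v e u` is again in the groupoid normalizer. -/
theorem IsCartanTriple.mul_mul_mem_groupoidNormalizer (h : IsCartanTriple M N D)
    {v u e : M.toStarSubalgebra} (hv : v ∈ groupoidNormalizer M D)
    (huN : (u : H →L[ℂ] H) ∈ N) (hu : (u : H →L[ℂ] H) ∈ unitary (H →L[ℂ] H))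
    (heD : (e : H →L[ℂ] H) ∈ D) (hes : star (e : H →L[ℂ] H) = e)
    (hee : (e : H →L[ℂ] H) * e = e) : v * e * u ∈ groupoidNormalizer M D := by
  have huu := Unitary.mul_star_self_of_mem hu
  have huu' := Unitary.star_mul_self_of_mem hu
  have hp := star_mul_self_mem hv
  have h3 := mul_star_mul_self hv
  refine ⟨Subtype.ext ?_, fun d hd => ?_⟩
  · change (v * e * u * star (v * e * u : H →L[ℂ] H) * (v * e * u) : H →L[ℂ] H) = v * e * u
    have hpe := h.abelian _ hp _ heD
    rw [star_mul, star_mul, hes]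
    calc (v * e * u * (star (u : H →L[ℂ] H) * (e * star (v : H →L[ℂ] H))) * (v * e * u) : H →L[ℂ] H)
        = v * e * (u * star (u : H →L[ℂ] H)) * e * (star (v : H →L[ℂ] H) * v * e) * u := by
          simp only [mul_assoc]
      _ = v * ((e * e) * e) * (star (v : H →L[ℂ] H) * v) * u := by
          rw [huu, hpe]; simp only [mul_assoc, mul_one]
      _ = v * (star (v : H →L[ℂ] H) * v * e) * u := by rw [hee, hee, hpe]; simp only [mul_assoc]
      _ = v * e * u := by rw [← mul_assoc, h3]
  · constructor
    · change star (v * e * u : H →L[ℂ] H) * d * (v * e * u : H →L[ℂ] H) ∈ D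
      have hd' : (e : H →L[ℂ] H) * (star (v : H →L[ℂ] H) * d * v) * e ∈ D :=
        mul_mem (mul_mem heD (hv.2 d hd).1) heD
      have : star (v * e * u : H →L[ℂ] H) * d * (v * e * u : H →L[ℂ] H) =
          e * (star (v : H →L[ℂ] H) * d * v) * e := by
        have hc := h.commute hd' huN
        rw [star_mul, star_mul, hes]
        calc _ = star (u : H →L[ℂ] H) * (e * (star (v : H →L[ℂ] H) * d * v) * e * u) := by
              simp only [mul_assoc]
          _ = _ := by rw [hc, ← mul_assoc, huu', one_mul]
      rwa [this]
    · change (v * e * u : H →L[ℂ] H) * d * star (v * e * u : H →L[ℂ] H) ∈ D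
      have : (v * e * u : H →L[ℂ] H) * d * star (v * e * u : H →L[ℂ] H) =
          v * (e * d * e) * star (v : H →L[ℂ] H) := by
        have hc := h.commute hd huN
        rw [star_mul, star_mul, hes]
        calc _ = v * e * (u * d) * star (u : H →L[ℂ] H) * e * star (v : H →L[ℂ] H) := by
              simp only [mul_assoc]
          _ = v * e * d * (u * star (u : H →L[ℂ] H)) * e * star (v : H →L[ℂ] H) := by
              rw [← hc]; simp only [mul_assoc]
          _ = _ := by rw [huu, mul_one]; simp only [mul_assoc]
      rw [this]
      exact (hv.2 _ (mul_mem (mul_mem heD hd) heD)).2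

/-! ### Conditional expectations and bimodules -/

variable {E : M.toStarSubalgebra →ₗ[ℂ] N.toStarSubalgebra}

theorem IsFaithfulNormalCondExp.map_mul_left (hE : IsFaithfulNormalCondExp M N E)
    (a x : M.toStarSubalgebra) (ha : (a : H →L[ℂ] H) ∈ N) :
    (E (a * x) : H →L[ℂ] H) = a * E x := by
  simpa using hE.map_mul_mul a x 1 ha (one_mem N)

theorem IsFaithfulNormalCondExp.isClosed_fiber (hE : IsFaithfulNormalCondExp M N E)
    (w : N.toStarSubalgebra) : IsClosed[M.weakStarTopology] {z | E z = w} :=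
  @IsClosed.preimage _ _ M.weakStarTopology N.weakStarTopology E hE.normal _
    (isClosed_weakStar_singleton w)

/-- Averaging over the unitary group of `D`: for a map `E` to the relative commutant of `D`, the
element `E y` is a weak limit of convex combinations of the conjugates `u y u*` with `u` a unitary
of `D`. -/
theorem IsFaithfulNormalCondExp.coe_apply_mem (hE : IsFaithfulNormalCondExp M N E)
    (h : IsCartanTriple M N D) {y : M.toStarSubalgebra} {K : Set (H →L[ℂ] H)}
    (hK : IsBddWeakClosed K) (hconv : Convex ℝ K) (hy : (y : H →L[ℂ] H) ∈ K)
    (hinv : ∀ u ∈ D, u ∈ unitary (H →L[ℂ] H) → ∀ z ∈ K, u * z * star u ∈ K) :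
    (E y : H →L[ℂ] H) ∈ K := by
  let F : Set (H →L[ℂ] H) := Subtype.val '' {z : M.toStarSubalgebra | E z = E y}
  let S : Set (H →L[ℂ] H) := {u | u ∈ D ∧ u ∈ unitary (H →L[ℂ] H)}
  obtain ⟨z, hz, hzS⟩ := exists_mem_forall_commute_unitary
    (K := K ∩ (F ∩ Metric.closedBall 0 ‖(y : H →L[ℂ] H)‖)) (S := S) (C := ‖(y : H →L[ℂ] H)‖)
    (hK.inter ((isBddWeakClosed_image (hE.isClosed_fiber _)).inter
      (isBddWeakClosed_closedBall _)))
    (fun z hz => mem_closedBall_zero_iff.1 hz.2.2)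
    (hconv.inter (Convex.inter (fun x hx z hz a b ha hb hab => by
      obtain ⟨x, hx, rfl⟩ := hx
      obtain ⟨z, hz, rfl⟩ := hz
      refine ⟨(a : ℂ) • x + (b : ℂ) • z, ?_, by simp⟩
      have hab' : (a : ℂ) + b = 1 := by exact_mod_cast hab
      rw [Set.mem_ofPred_eq] at hx hz ⊢
      rw [map_add, map_smul, map_smul, hx, hz, ← add_smul, hab', one_smul])
      (convex_closedBall _ _)))
    ⟨y, hy, ⟨y, rfl, rfl⟩, by simp⟩ (fun u hu => hu.2)
    (fun u hu w hw => h.abelian u hu.1 w hw.1)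
    (by
      rintro u ⟨huD, hu⟩ _ ⟨hzK, ⟨z, hz, rfl⟩, hzn⟩
      refine ⟨hinv u huD hu _ hzK, ⟨⟨u, h.le huD⟩ * z * star ⟨u, h.le huD⟩, ?_, rfl⟩, ?_⟩
      · have huN := h.le_relCommutant huD
        rw [Set.mem_ofPred_eq] at hz ⊢
        refine Subtype.ext ?_
        rw [hE.map_mul_mul _ _ _ huN (star_mem huN), hz]
        change u * (E y : H →L[ℂ] H) * star u = E y
        rw [h.commute huD (E y).2, mul_assoc, Unitary.mul_star_self_of_mem hu, mul_one]
      · rw [mem_closedBall_zero_iff] at hzn ⊢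
        rwa [CStarRing.norm_mul_mem_unitary _ (Unitary.star_mem hu),
          CStarRing.norm_mem_unitary_mul _ hu])
  obtain ⟨hzK, ⟨z, hz, rfl⟩, -⟩ := hz
  have hzN : (z : H →L[ℂ] H) ∈ N := (h.relCommutant _).2 ⟨z.2, fun d hd => by
    obtain ⟨u, c, huD, hu, rfl⟩ := D.exists_sum_four_unitary hd
    simp only [Finset.sum_mul, Finset.mul_sum, smul_mul_assoc, mul_smul_comm]
    exact Finset.sum_congr rfl fun i _ => by rw [hzS (u i) ⟨huD i, hu i⟩]⟩
  rw [← show E z = E y from hz, hE.map_of_mem z hzN]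
  exact hzK

/-- The set of `z` with `v z ∈ B` is stable under conjugation by unitaries `u` of `D`, because
`v u z u* = (v u v*) (v z) u*`; so it contains `E(v* x)` along with `v* x`. -/
theorem IsFaithfulNormalCondExp.mul_apply_mem (hE : IsFaithfulNormalCondExp M N E)
    (h : IsCartanTriple M N D) {B : Submodule ℂ M.toStarSubalgebra}
    (hBclosed : IsClosed[M.weakStarTopology] (B : Set M.toStarSubalgebra)) (hB : IsBimodule M N B)
    {x v : M.toStarSubalgebra} (hx : x ∈ B) (hv : v ∈ groupoidNormalizer M D) :
    (v : H →L[ℂ] H) * (E (star v * x) : H →L[ℂ] H) ∈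
      B.map M.toStarSubalgebra.subtype.toAlgHom.toLinearMap := by
  refine hE.coe_apply_mem h (K := {z | (v : H →L[ℂ] H) * z ∈
      B.map M.toStarSubalgebra.subtype.toAlgHom.toLinearMap})
    ((isBddWeakClosed_image hBclosed).preimage_mul_left _) ?_ ?_ ?_
  · intro a ha b hb s t _ _ _
    rw [Set.mem_ofPred_eq] at ha hb ⊢
    rw [mul_add, mul_smul_comm, mul_smul_comm]
    exact add_mem (Submodule.smul_of_tower_mem _ s ha) (Submodule.smul_of_tower_mem _ t hb)
  · refine ⟨v * star v * x, (hB _ x (h.le_relCommutant (mul_star_self_mem hv)) hx).1, ?_⟩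
    exact mul_assoc (v : H →L[ℂ] H) (star (v : H →L[ℂ] H)) x
  · rintro u huD hu z ⟨b, hb, hbz⟩
    have huN := h.le_relCommutant huD
    refine ⟨⟨v * u * star (v : H →L[ℂ] H), mul_mem (mul_mem v.2 (h.le huD)) (star_mem v.2)⟩ * b *
      ⟨star u, h.le (star_mem huD)⟩, (hB _ _ (star_mem huN) (hB _ _ (h.conj_mem hv huN) hb).1).2, ?_⟩
    change v * u * star (v : H →L[ℂ] H) * (b : H →L[ℂ] H) * star u = v * (u * z * star u)
    have hbz' : (b : H →L[ℂ] H) = v * z := hbz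
    rw [hbz', ← mul_assoc _ (v : H →L[ℂ] H) z, h.conj_mul hv huN]
    simp only [mul_assoc]

/-- The core of the argument: the elements `m` of `N` with `v m ∈ B` form an ideal of `N`, whose
unit `e` is a projection of the center `D` of `N`. If `n` in the ideal is written as a combination
of unitaries `uᵢ`, then `v n = v e n` is a combination of the elements `v e uᵢ` of `B`. -/
theorem IsFullCartanTriple.exists_sum_four_groupoidNormalizer (h : IsFullCartanTriple M N D)
    {B : Submodule ℂ M.toStarSubalgebra}
    (hBclosed : IsClosed[M.weakStarTopology] (B : Set M.toStarSubalgebra)) (hB : IsBimodule M N B)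
    {v : M.toStarSubalgebra} (hv : v ∈ groupoidNormalizer M D) {n : H →L[ℂ] H} (hn : n ∈ N)
    (hvn : v * n ∈ B.map M.toStarSubalgebra.subtype.toAlgHom.toLinearMap) :
    ∃ (c : Fin 4 → ℂ) (w : Fin 4 → M.toStarSubalgebra),
      (∀ i, w i ∈ groupoidNormalizer M D ∩ B) ∧
      (v : H →L[ℂ] H) * n = ∑ i, c i • (w i : H →L[ℂ] H) := by
  have hC := h.toIsCartanTriple
  have hNM : ∀ m ∈ N, m ∈ M := fun m hm => ((hC.relCommutant m).1 hm).1
  let J : Submodule ℂ (H →L[ℂ] H) :=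
    { carrier := {z | z ∈ N ∧ (v : H →L[ℂ] H) * z ∈
        B.map M.toStarSubalgebra.subtype.toAlgHom.toLinearMap}
      add_mem' := fun ha hb => ⟨add_mem ha.1 hb.1, by
        rw [mul_add]; exact add_mem ha.2 hb.2⟩
      zero_mem' := ⟨zero_mem N, by rw [mul_zero]; exact zero_mem _⟩
      smul_mem' := fun c a ha => ⟨N.toStarSubalgebra.smul_mem ha.1 c, by
        rw [mul_smul_comm]; exact Submodule.smul_mem _ c ha.2⟩ }
  have hr : ∀ m ∈ N, ∀ z ∈ J, z * m ∈ J := by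
    rintro m hm z ⟨hzN, b, hb, hbz⟩
    refine ⟨mul_mem hzN hm, b * ⟨m, hNM m hm⟩, (hB _ b hm hb).2, ?_⟩
    have hbz' : (b : H →L[ℂ] H) = v * z := hbz
    change (b : H →L[ℂ] H) * m = v * (z * m)
    rw [hbz', mul_assoc]
  have hl : ∀ m ∈ N, ∀ z ∈ J, m * z ∈ J := by
    rintro m hm z ⟨hzN, b, hb, hbz⟩
    have hm' := hC.conj_mem hv hm
    refine ⟨mul_mem hm hzN, ⟨_, hNM _ hm'⟩ * b, (hB _ b hm' hb).1, ?_⟩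
    have hbz' : (b : H →L[ℂ] H) = v * z := hbz
    change v * m * star (v : H →L[ℂ] H) * (b : H →L[ℂ] H) = v * (m * z)
    rw [hbz', ← mul_assoc, hC.conj_mul hv hm, mul_assoc]
  obtain ⟨e, heJ, hes, hee, hec, heJl⟩ := exists_central_projection_of_ideal (N := N) J
    (N.isBddWeakClosed.inter ((isBddWeakClosed_image hBclosed).preimage_mul_left v))
    (fun z hz => hz.1) hl hr
  have heD : e ∈ D := (h.full e).2 ⟨heJ.1, hec⟩
  obtain ⟨u, c, huN, hu, hnu⟩ := N.exists_sum_four_unitary hn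
  refine ⟨c, fun i => v * ⟨e, hC.le heD⟩ * ⟨u i, hNM _ (huN i)⟩, fun i => ⟨?_, ?_⟩, ?_⟩
  · exact hC.mul_mul_mem_groupoidNormalizer hv (huN i) (hu i) heD hes hee
  · obtain ⟨-, b, hb, hbz⟩ := hr (u i) (huN i) e heJ
    convert hb using 1
    refine Subtype.ext (Eq.trans ?_ hbz.symm)
    exact mul_assoc (v : H →L[ℂ] H) e (u i)
  · rw [← heJl n ⟨hn, hvn⟩, hnu, Finset.mul_sum, Finset.mul_sum]
    refine Finset.sum_congr rfl fun i _ => ?_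
    rw [mul_smul_comm, mul_smul_comm, ← mul_assoc]
    rfl

/-- Regularity of `D`: if `v E(v* x) = 0` for all `v` in the groupoid normalizer, then
`E(z x) = 0` for all `z` in a weak-`*` dense subspace, hence `E(x* x) = 0`. -/
theorem IsFaithfulNormalCondExp.exists_mul_apply_ne_zero (hE : IsFaithfulNormalCondExp M N E)
    (h : IsCartanTriple M N D) {x : M.toStarSubalgebra} (hx : x ≠ 0) :
    ∃ v ∈ groupoidNormalizer M D, (v : H →L[ℂ] H) * (E (star v * x) : H →L[ℂ] H) ≠ 0 := by
  by_contra! hzero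
  have hv : ∀ v ∈ groupoidNormalizer M D, E (v * x) = 0 := fun v hv => by
    have hv' := star_mem_groupoidNormalizer hv
    have h1 := hzero _ hv'
    have h2 := hE.map_mul_left (star (star v) * star v) (star (star v) * x)
      (h.le_relCommutant (star_mul_self_mem hv'))
    rw [star_star, ← mul_assoc (v * star v), hv.1] at h2
    rw [star_star] at h1
    refine Subtype.ext (h2.trans ?_)
    change (v : H →L[ℂ] H) * star (v : H →L[ℂ] H) * (E (v * x) : H →L[ℂ] H) = 0
    change star (v : H →L[ℂ] H) * (E (v * x) : H →L[ℂ] H) = 0 at h1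
    rw [mul_assoc, h1, mul_zero]
  let P : Submodule ℂ M.toStarSubalgebra := LinearMap.ker (E ∘ₗ LinearMap.mulRight ℂ x)
  have hP : IsClosed[M.weakStarTopology] (P : Set M.toStarSubalgebra) :=
    @IsClosed.preimage _ _ M.weakStarTopology M.weakStarTopology _
      (continuous_weakStar_mul_right x) _ (hE.isClosed_fiber 0)
  have hspan : Submodule.span ℂ (groupoidNormalizer M D) ≤ P := Submodule.span_le.2 hv
  have htop : star x ∈ P := @closure_minimal _ M.weakStarTopology _ _ hspan hP _ (h.regular (star x))
  exact hx (hE.faithful x htop)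

end VonNeumannAlgebra

open ContinuousLinearMap VonNeumannAlgebra in
theorem theorem5p1 {H : Type*} [NormedAddCommGroup H] [InnerProductSpace ℂ H] [CompleteSpace H]
    (M N D : VonNeumannAlgebra H) (hMND : VonNeumannAlgebra.IsFullCartanTriple M N D)
    (B : Submodule ℂ M.toStarSubalgebra) (hB0 : B ≠ ⊥)
    (hBclosed : IsClosed[M.weakStarTopology] (B : Set M.toStarSubalgebra))
    (hB : VonNeumannAlgebra.IsBimodule M N B) :
    (∃ w ∈ VonNeumannAlgebra.groupoidNormalizer M D ∩ B, w ≠ 0) ∧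
    ∀ E : M.toStarSubalgebra →ₗ[ℂ] N.toStarSubalgebra,
      VonNeumannAlgebra.IsFaithfulNormalCondExp M N E →
      ∀ x ∈ B, ∀ v ∈ VonNeumannAlgebra.groupoidNormalizer M D,
        ∃ k : ℕ, k ≤ 4 ∧ ∃ (c : Fin k → ℂ) (w : Fin k → M.toStarSubalgebra),
          (∀ i, w i ∈ VonNeumannAlgebra.groupoidNormalizer M D ∩ B) ∧
          (v : H →L[ℂ] H) * (E (star v * x) : H →L[ℂ] H) =
            ∑ i, c i • (w i : H →L[ℂ] H) := by
  have hC := hMND.toIsCartanTriple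
  have hmain : ∀ E : M.toStarSubalgebra →ₗ[ℂ] N.toStarSubalgebra,
      IsFaithfulNormalCondExp M N E → ∀ x ∈ B, ∀ v ∈ groupoidNormalizer M D,
        ∃ (c : Fin 4 → ℂ) (w : Fin 4 → M.toStarSubalgebra),
          (∀ i, w i ∈ groupoidNormalizer M D ∩ B) ∧
          (v : H →L[ℂ] H) * (E (star v * x) : H →L[ℂ] H) = ∑ i, c i • (w i : H →L[ℂ] H) :=
    fun E hE x hx v hv =>
      hMND.exists_sum_four_groupoidNormalizer hBclosed hB hv (E (star v * x)).2
        (hE.mul_apply_mem hC hBclosed hB hx hv)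
  refine ⟨?_, fun E hE x hx v hv => ⟨4, le_rfl, hmain E hE x hx v hv⟩⟩
  obtain ⟨E, hE⟩ := hC.exists_condExp
  obtain ⟨x, hx, hx0⟩ := B.exists_mem_ne_zero_of_ne_bot hB0
  obtain ⟨v, hv, hvx⟩ := hE.exists_mul_apply_ne_zero hC hx0
  obtain ⟨c, w, hw, hsum⟩ := hmain E hE x hx v hv
  by_contra! hzero
  exact hvx (hsum.trans (Finset.sum_eq_zero fun i _ => by simp [hzero (w i) (hw i)]))
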